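/- Let $\mathcal{D}$ be a model category and let $X\colon \Delta^{op}\to\mathcal{D}$ be a simplicial object, with face maps $d_i\colon X_n\to X_{n-1}$. For a nonempty subset $I=\{i_0<\dots<i_k\}\subseteq\{0,1,\dots,n\}$ write $X_I$ for $X_k$; the inclusion $I\subseteq\{0,\dots,n\}$ induces a map $X_n\to X_I$, and an inclusion $K\subseteq I$ induces a map $X_I\to X_K$. Write $B\times^h_D E$ for the homotopy pullback in $\mathcal{D}$ of a cospan $B\to D\leftarrow E$: choose a trivial cofibration $D\to D'$ with $D'$ fibrant, factor $B\to D'$ and $E\to D'$ as trivial cofibrations $B\to B'$, $E\to E'$ followed by fibrations $B'\to D'$, $E'\to D'$, and take $B'\times_{D'}E'$. A commutative square with initial corner $A$ and remaining cospan $B\to D\leftarrow E$ is called homotopy cartesian if the induced map $A\to B\times^h_D E$ is a weak equivalence. We say that $X$ is * left $2$-Segal if for all $n\ge 3$ and $0\le j\le n$ the map $X_n\to X_{\{0,j,j+1,\dots,n\}}\times^h_{X_{\{0,j\}}}X_{\{0,1,\dots,j\}}$ is a weak equivalence; * right $2$-Segal if for all $n\ge 3$ and $0\le j\le n$ the map $X_n\to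 X_{\{0,1,\dots,j,n\}}\times^h_{X_{\{j,n\}}}X_{\{j,j+1,\dots,n\}}$ is a weak equivalence; * upper $2$-Segal if for all $0<i<n$ the square formed by $d_0,\,d_{i+1}\colon X_{n+1}\to X_n$ and $d_i,\,d_0\colon X_n\to X_{n-1}$ (so $d_i d_0=d_0 d_{i+1}$) is homotopy cartesian; * lower $2$-Segal if for all $0<i<n$ the square formed by $d_{n+1},\,d_i\colon X_{n+1}\to X_n$ and $d_i,\,d_n\colon X_n\to X_{n-1}$ (so $d_i d_{n+1}=d_n d_i$) is homotopy cartesian. Proposition A.2. A simplicial object $X$ in a model category is upper $2$-Segal if and only if it is right $2$-Segal, and it is lower $2$-Segal if and only if it is left $2$-Segal. -/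

import Mathlib

open CategoryTheory CategoryTheory.Limits HomotopicalAlgebra Opposite

universe v u

namespace TwoSegal

noncomputable section

section HomotopyPullback

variable {C : Type u} [Category.{v} C] [ModelCategory C]

/-- A chosen factorization of a morphism as a trivial cofibration followed by a fibration. -/
def fact {A B : C} (f : A ⟶ B) :
    MorphismProperty.MapFactorizationData (trivialCofibrations C) (fibrations C) f :=
  MorphismProperty.factorizationData (trivialCofibrations C) (fibrations C) f

/-- The fibrant replacement of an object `D`: the map from `D` to the terminal object is factored
as a trivial cofibration `D ⟶ fibrantReplacement D` followed by a fibration. -/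
abbrev fibrantReplacement (D : C) : C := (fact (terminal.from D)).Z

/-- The trivial cofibration from an object to its fibrant replacement. -/
def toFibrantReplacement (D : C) : D ⟶ fibrantReplacement D := (fact (terminal.from D)).i

/-- The homotopy pullback `B ×ʰ_D E` of a cospan `f : B ⟶ D`, `g : E ⟶ D` in a model category:
replace `D` by a fibrant object `D'`, factor both composites `B ⟶ D'` and `E ⟶ D'` as a trivial
cofibration followed by a fibration, and take the strict pullback of the two fibrations.
No properness of the model category is required. -/
abbrev homotopyPullback {B D E : C} (f : B ⟶ D) (g : E ⟶ D) : C :=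
  pullback (fact (f ≫ toFibrantReplacement D)).p (fact (g ≫ toFibrantReplacement D)).p

/-- The canonical map `A ⟶ B ×ʰ_D E` induced by maps `a : A ⟶ B` and `b : A ⟶ E` which agree
on `D`. -/
def toHomotopyPullback {A B D E : C} (f : B ⟶ D) (g : E ⟶ D) (a : A ⟶ B) (b : A ⟶ E)
    (w : a ≫ f = b ≫ g) : A ⟶ homotopyPullback f g :=
  pullback.lift (a ≫ (fact (f ≫ toFibrantReplacement D)).i)
    (b ≫ (fact (g ≫ toFibrantReplacement D)).i) (by
      simp only [Category.assoc, MorphismProperty.MapFactorizationData.fac]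
      rw [← Category.assoc, w, Category.assoc])

/-- A commutative square with top map `t : A ⟶ B`, left map `l : A ⟶ E`, right map `r : B ⟶ D`
and bottom map `b : E ⟶ D` is homotopy cartesian if the canonical map `A ⟶ B ×ʰ_D E` is a weak equivalence. -/
def IsHomotopyCartesian {A B D E : C} {t : A ⟶ B} {l : A ⟶ E} {r : B ⟶ D} {b : E ⟶ D}
    (sq : CommSq t l r b) : Prop :=
  WeakEquivalence (toHomotopyPullback r b t l sq.w)

end HomotopyPullback

section Faces

variable {n : ℕ}

theorem card_eq {I : Finset (Fin (n + 1))} (hI : I.Nonempty) : I.card = I.card - 1 + 1 :=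
  (Nat.succ_pred_eq_of_pos hI.card_pos).symm

/-- The unique order isomorphism `[k] ≃ {i₀ < ⋯ < iₖ} = I`, for a nonempty set `I` of vertices
of `[n]`. -/
def vertexIso (I : Finset (Fin (n + 1))) (hI : I.Nonempty) : Fin (I.card - 1 + 1) ≃o I :=
  I.orderIsoOfFin (card_eq hI)

/-- The order-preserving inclusion `[k] ⟶ [n]` with image `I = {i₀ < ⋯ < iₖ}`. -/
def face (I : Finset (Fin (n + 1))) (hI : I.Nonempty) :
    SimplexCategory.mk (I.card - 1) ⟶ SimplexCategory.mk n :=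
  SimplexCategory.mkHom
    ⟨fun x => (vertexIso I hI x : Fin (n + 1)), fun _ _ h => (vertexIso I hI).monotone h⟩

/-- For `I = {i₀ < ⋯ < iₖ}` contained in `J = {j₀ < ⋯ < jₘ}`, the map `[k] ⟶ [m]` corresponding
to the inclusion of `I` in `J`. -/
def faceIncl {I J : Finset (Fin (n + 1))} (hI : I.Nonempty) (hIJ : I ⊆ J) :
    SimplexCategory.mk (I.card - 1) ⟶ SimplexCategory.mk (J.card - 1) :=
  SimplexCategory.mkHom
    ⟨fun x => (vertexIso J (hI.mono hIJ)).symm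
        ⟨(vertexIso I hI x : Fin (n + 1)), hIJ (vertexIso I hI x).2⟩,
      fun _ _ h => (vertexIso J (hI.mono hIJ)).symm.monotone ((vertexIso I hI).monotone h)⟩

theorem faceIncl_comp_face {I J : Finset (Fin (n + 1))} (hI : I.Nonempty) (hIJ : I ⊆ J) :
    faceIncl hI hIJ ≫ face J (hI.mono hIJ) = face I hI := by
  ext x : 3
  exact congrArg Subtype.val ((vertexIso J (hI.mono hIJ)).apply_symm_apply _)

variable {C : Type u} [Category.{v} C] (X : SimplicialObject C)

/-- The object `X_I` for a set `I = {i₀ < ⋯ < iₖ}` of vertices of `[n]`; it is `Xₖ`. -/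
abbrev faceObj (I : Finset (Fin (n + 1))) : C :=
  X.obj (op (SimplexCategory.mk (I.card - 1)))

/-- The map `Xₙ ⟶ X_I` induced by the inclusion of `I` in `[n]`. -/
def toFace (I : Finset (Fin (n + 1))) (hI : I.Nonempty) :
    X.obj (op (SimplexCategory.mk n)) ⟶ faceObj X I :=
  X.map (face I hI).op

/-- The map `X_J ⟶ X_I` induced by an inclusion of `I` in `J`. -/
def faceRestr {I J : Finset (Fin (n + 1))} (hI : I.Nonempty) (hIJ : I ⊆ J) :
    faceObj X J ⟶ faceObj X I :=
  X.map (faceIncl hI hIJ).op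

theorem toFace_comp_faceRestr {I J : Finset (Fin (n + 1))} (hI : I.Nonempty) (hIJ : I ⊆ J) :
    toFace X J (hI.mono hIJ) ≫ faceRestr X hI hIJ = toFace X I hI := by
  refine (X.map_comp _ _).symm.trans ?_
  rw [← op_comp, faceIncl_comp_face]
  rfl

/-- For a nonempty set `K` of vertices of `[n]` contained in `I` and in `J`, the canonical map
`Xₙ ⟶ X_I ×ʰ_{X_K} X_J`. -/
def segalMap [ModelCategory C] {I J K : Finset (Fin (n + 1))} (hK : K.Nonempty)
    (hI : K ⊆ I) (hJ : K ⊆ J) :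
    X.obj (op (SimplexCategory.mk n)) ⟶
      homotopyPullback (faceRestr X hK hI) (faceRestr X hK hJ) :=
  toHomotopyPullback _ _ (toFace X I (hK.mono hI)) (toFace X J (hK.mono hJ)) (by
    rw [toFace_comp_faceRestr, toFace_comp_faceRestr])

end Faces

section Subsets

variable {n : ℕ} (j : Fin (n + 1))

/-- The set `{0, j, j + 1, …, n}`. -/
def zeroAndFrom : Finset (Fin (n + 1)) := insert 0 (Finset.Ici j)

/-- The set `{0, 1, …, j}`. -/
def upTo : Finset (Fin (n + 1)) := Finset.Iic j

/-- The set `{0, 1, …, j, n}`. -/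
def upToAndLast : Finset (Fin (n + 1)) := insert (Fin.last n) (Finset.Iic j)

/-- The set `{j, j + 1, …, n}`. -/
def fromOn : Finset (Fin (n + 1)) := Finset.Ici j

theorem pair_subset_zeroAndFrom : {0, j} ⊆ zeroAndFrom j := by
  simp [zeroAndFrom, Finset.insert_subset_iff]

theorem pair_subset_upTo : {0, j} ⊆ upTo j := by
  simp [upTo, Finset.insert_subset_iff]

theorem pair_subset_upToAndLast : {j, Fin.last n} ⊆ upToAndLast j := by
  simp [upToAndLast, Finset.insert_subset_iff]

theorem pair_subset_fromOn : {j, Fin.last n} ⊆ fromOn j := by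
  simp [fromOn, Finset.insert_subset_iff, Fin.le_last]

end Subsets

section Squares

variable {C : Type u} [Category.{v} C] (X : SimplicialObject C)

/-- With `n = m + 1`, the commutative square with top map `d_0 : X_{n+1} ⟶ X_n`, left map
`d_{i+1} : X_{n+1} ⟶ X_n`, right map `d_i : X_n ⟶ X_{n-1}` and bottom map
`d_0 : X_n ⟶ X_{n-1}`. -/
theorem upperSquare (m : ℕ) (i : Fin (m + 2)) :
    CommSq (X.δ (0 : Fin (m + 3))) (X.δ i.succ) (X.δ i) (X.δ (0 : Fin (m + 2))) :=
  ⟨(X.δ_comp_δ (Fin.zero_le i)).symm⟩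

/-- With `n = m + 1`, the commutative square with top map `d_{n+1} : X_{n+1} ⟶ X_n`, left map
`d_i : X_{n+1} ⟶ X_n`, right map `d_i : X_n ⟶ X_{n-1}` and bottom map
`d_n : X_n ⟶ X_{n-1}`. -/
theorem lowerSquare (m : ℕ) (i : Fin (m + 2)) :
    CommSq (X.δ (Fin.last (m + 2))) (X.δ i.castSucc) (X.δ i) (X.δ (Fin.last (m + 1))) :=
  ⟨X.δ_comp_δ (Fin.le_last i)⟩

end Squares

section Conditions

variable {C : Type u} [Category.{v} C] [ModelCategory C] (X : SimplicialObject C)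

/-- `X` is left 2-Segal if `Xₙ ⟶ X_{0, j, j+1, …, n} ×ʰ_{X_{0, j}} X_{0, 1, …, j}` is a weak
equivalence for all `n ≥ 3` and `0 ≤ j ≤ n`. -/
def IsLeftTwoSegal : Prop :=
  ∀ (n : ℕ), 3 ≤ n → ∀ j : Fin (n + 1),
    WeakEquivalence (segalMap X (Finset.insert_nonempty 0 {j})
      (pair_subset_zeroAndFrom j) (pair_subset_upTo j))

/-- `X` is right 2-Segal if `Xₙ ⟶ X_{0, 1, …, j, n} ×ʰ_{X_{j, n}} X_{j, j+1, …, n}` is a weak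
equivalence for all `n ≥ 3` and `0 ≤ j ≤ n`. -/
def IsRightTwoSegal : Prop :=
  ∀ (n : ℕ), 3 ≤ n → ∀ j : Fin (n + 1),
    WeakEquivalence (segalMap X (Finset.insert_nonempty j {Fin.last n})
      (pair_subset_upToAndLast j) (pair_subset_fromOn j))

/-- `X` is upper 2-Segal if the square formed by `d_0, d_{i+1} : X_{n+1} ⟶ X_n` and
`d_i, d_0 : X_n ⟶ X_{n-1}` is homotopy cartesian for all `0 < i < n`
(where `n` is written `m + 1`). -/
def IsUpperTwoSegal : Prop :=
  ∀ (m : ℕ) (i : Fin (m + 2)), 0 < i → i < Fin.last (m + 1) →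
    IsHomotopyCartesian (upperSquare X m i)

/-- `X` is lower 2-Segal if the square formed by `d_{n+1}, d_i : X_{n+1} ⟶ X_n` and
`d_i, d_n : X_n ⟶ X_{n-1}` is homotopy cartesian for all `0 < i < n`
(where `n` is written `m + 1`). -/
def IsLowerTwoSegal : Prop :=
  ∀ (m : ℕ) (i : Fin (m + 2)), 0 < i → i < Fin.last (m + 1) →
    IsHomotopyCartesian (lowerSquare X m i)

end Conditions

end

end TwoSegal

/-! Let (j, k) denote the square with corners X_{k+j}, X_{0,…,j,k+j}, X_{j,…,k+j} and X_{j,k+j}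
(`IsCartesianAt`). Being right 2-Segal means that all squares (j, k) with j, k ≥ 1 are homotopy
cartesian: at the extreme vertices 0 and n a pair of opposite sides of the Segal square consists of
isomorphisms, and the same happens when k = 1, which also disposes of n = 2.

The upper 2-Segal squares generate these by pasting. An upper square pasted with (1, k) is (1, k+1),
for every interior i. So the upper condition is equivalent to all (1, k) being homotopy cartesian,
by induction from the trivial (1, 1) (`isHomotopyCartesian_upperSquare_iff`). For larger j, one
auxiliary square pastes with (1, j+1) to (1, k+j) and with (j, k) to (j+1, k), which gives an
induction on j (`isCartesianAt_succ`). Reversing the order of vertices turns upper into lower and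
right into left.

The homotopical input is the pasting law. Without properness it rests on `isHomotopyCartesian_iff`:
any replacement of the cospan by fibrations between fibrant objects may be used. This follows from
homotopy invariance of such pullbacks, proved by Ken Brown's factorization. -/

namespace TwoSegal

/-! ### Pullbacks along fibrations and their homotopy invariance -/

section ModelCategory

variable {C : Type u} [Category.{v} C] [ModelCategory C]

theorem fibration_of_isPullback {P B E D : C} {t : P ⟶ B} {l : P ⟶ E} {r : B ⟶ D} {b : E ⟶ D}
    (h : IsPullback t l r b) [hr : Fibration r] : Fibration l := by
  rw [fibration_iff] at hr ⊢
  exact MorphismProperty.of_isPullback h hr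

theorem weakEquivalence_of_isPullback_of_fibration {P B E D : C} {t : P ⟶ B} {l : P ⟶ E}
    {r : B ⟶ D} {b : E ⟶ D} (h : IsPullback t l r b) [Fibration r] [WeakEquivalence r] :
    WeakEquivalence l := by
  rw [weakEquivalence_iff]
  exact (MorphismProperty.of_isPullback h (mem_trivialFibrations r)).2

theorem weakEquivalence_of_comp_eq_id {A B : C} {s : A ⟶ B} {t : B ⟶ A} (h : s ≫ t = 𝟙 A)
    [WeakEquivalence t] : WeakEquivalence s :=
  weakEquivalence_of_postcomp_of_fac h

/-- Ken Brown's factorization relative to a base: a weak equivalence between fibrations over `B`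
is a section of a trivial fibration followed by a trivial fibration, over `B`. -/
theorem exists_brown_factorization_over {B E₁ E₂ : C} (p₁ : E₁ ⟶ B) (p₂ : E₂ ⟶ B)
    [Fibration p₁] [Fibration p₂] (φ : E₁ ⟶ E₂) [WeakEquivalence φ] (hφ : φ ≫ p₂ = p₁) :
    ∃ (Z : C) (j : E₁ ⟶ Z) (q₁ : Z ⟶ E₁) (q₂ : Z ⟶ E₂), j ≫ q₁ = 𝟙 E₁ ∧ j ≫ q₂ = φ ∧
      q₁ ≫ p₁ = q₂ ≫ p₂ ∧ Fibration q₁ ∧ WeakEquivalence q₁ ∧ Fibration q₂ ∧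
      WeakEquivalence q₂ := by
  -- Factor the graph of `φ` in the fibre product over `B`; both projections of the fibre product
  -- are fibrations, as base changes of `p₂` and `p₁`.
  let γ : E₁ ⟶ pullback p₁ p₂ := pullback.lift (𝟙 E₁) φ (by simp [hφ])
  let h := fact γ
  have h₁ : h.i ≫ h.p ≫ pullback.fst p₁ p₂ = 𝟙 E₁ := by
    rw [← Category.assoc, h.fac, pullback.lift_fst]
  have h₂ : h.i ≫ h.p ≫ pullback.snd p₁ p₂ = φ := by
    rw [← Category.assoc, h.fac, pullback.lift_snd]
  refine ⟨h.Z, h.i, h.p ≫ pullback.fst _ _, h.p ≫ pullback.snd _ _, h₁, h₂,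
    by simp [pullback.condition], inferInstance, weakEquivalence_of_precomp_of_fac h₁,
    inferInstance, weakEquivalence_of_precomp_of_fac h₂⟩

/-- Base change preserves weak equivalences between fibrations over `B`. -/
theorem weakEquivalence_baseChange_of_fibrations {B B' E₁ E₂ F₁ F₂ : C} {p₁ : E₁ ⟶ B}
    {p₂ : E₂ ⟶ B} [Fibration p₁] [Fibration p₂] (φ : E₁ ⟶ E₂) [WeakEquivalence φ]
    (hφ : φ ≫ p₂ = p₁) {u : B' ⟶ B} {t₁ : F₁ ⟶ E₁} {t₂ : F₂ ⟶ E₂} {l₁ : F₁ ⟶ B'} {l₂ : F₂ ⟶ B'}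
    (h₁ : IsPullback t₁ l₁ p₁ u) (h₂ : IsPullback t₂ l₂ p₂ u) (ψ : F₁ ⟶ F₂)
    (ht : ψ ≫ t₂ = t₁ ≫ φ) (hl : ψ ≫ l₂ = l₁) : WeakEquivalence ψ := by
  obtain ⟨Z, j, q₁, q₂, hj₁, hj₂, hq, _, _, _, _⟩ := exists_brown_factorization_over p₁ p₂ φ hφ
  have hG := IsPullback.of_hasPullback q₁ t₁
  have hG₁ : IsPullback (pullback.fst q₁ t₁) (pullback.snd q₁ t₁ ≫ l₁) (q₁ ≫ p₁) u :=
    hG.paste_vert h₁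
  -- The pullback of `Z` to `B'` lies over `F₁` and `F₂` by base changes `pullback.snd q₁ t₁` and
  -- `m` of the trivial fibrations `q₁` and `q₂`; `ψ` is a section of the first followed by the
  -- second.
  let m : pullback q₁ t₁ ⟶ F₂ := h₂.lift (pullback.fst q₁ t₁ ≫ q₂) (pullback.snd q₁ t₁ ≫ l₁)
    (by rw [Category.assoc, ← hq, hG₁.w])
  have hG₂ : IsPullback (pullback.fst q₁ t₁) m q₂ t₂ := by
    refine IsPullback.of_bot (t := h₂) ?_ (h₂.lift_fst _ _ _).symm
    rw [h₂.lift_snd, ← hq]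
    exact hG₁
  have : WeakEquivalence m := weakEquivalence_of_isPullback_of_fibration hG₂
  let k : F₁ ⟶ pullback q₁ t₁ := pullback.lift (t₁ ≫ j) (𝟙 _) (by simp [hj₁])
  have : WeakEquivalence k :=
    weakEquivalence_of_comp_eq_id (t := pullback.snd q₁ t₁) (pullback.lift_snd _ _ _)
  have hk : k ≫ pullback.fst q₁ t₁ = t₁ ≫ j := pullback.lift_fst _ _ _
  have hk' : k ≫ pullback.snd q₁ t₁ = 𝟙 _ := pullback.lift_snd _ _ _
  have : k ≫ m = ψ := by
    apply h₂.hom_ext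
    · simp [m, reassoc_of% hk, ht, hj₂]
    · simp [m, reassoc_of% hk', hl]
  rw [← this]
  infer_instance

/-- The base change of a section of a trivial fibration along a fibration is a weak
equivalence. -/
theorem weakEquivalence_baseChange_of_section {B B' E E' : C} {s : B' ⟶ B} {t : B ⟶ B'}
    (hst : s ≫ t = 𝟙 B') [Fibration t] [WeakEquivalence t] {p : E ⟶ B} [Fibration p]
    {f : E' ⟶ E} {p' : E' ⟶ B'} (h : IsPullback f p' p s) : WeakEquivalence f := by
  have hQ := IsPullback.of_hasPullback t (p ≫ t)
  -- `φ` embeds `E` in B ×_{B'} E over `B`. Because `s ≫ t = 𝟙 B'`, the pullback of B ×_{B'} E along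
  -- `s` is `E` itself, so `f` is the base change of `φ` along `s`.
  let φ : E ⟶ pullback t (p ≫ t) := pullback.lift p (𝟙 E) (by simp)
  have : WeakEquivalence φ :=
    weakEquivalence_of_comp_eq_id (t := pullback.snd t (p ≫ t)) (pullback.lift_snd _ _ _)
  have h₂ : IsPullback (pullback.lift (p ≫ t ≫ s) (𝟙 E) (by simp [hst])) (p ≫ t)
      (pullback.fst t (p ≫ t)) s := by
    refine IsPullback.of_right (t := hQ.flip) ?_ (pullback.lift_fst _ _ _ |>.trans (by simp))
    rw [pullback.lift_snd, hst]
    exact IsPullback.of_horiz_isIso ⟨by simp⟩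
  refine weakEquivalence_baseChange_of_fibrations φ (pullback.lift_fst _ _ _) h h₂ f ?_ ?_
  · ext
    · simp only [Category.assoc, pullback.lift_fst, φ]
      rw [h.w_assoc, h.w, reassoc_of% hst]
    · simp only [Category.assoc, pullback.lift_snd, φ]
  · rw [h.w_assoc, hst, Category.comp_id]

/-- The base change of a weak equivalence between fibrant objects along a fibration is a weak
equivalence. -/
theorem weakEquivalence_baseChange_of_isFibrant {B B' E E' : C} {f : B' ⟶ B} [IsFibrant B]
    [IsFibrant B'] [WeakEquivalence f] {p : E ⟶ B} [Fibration p] {f' : E' ⟶ E} {p' : E' ⟶ B'}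
    (h : IsPullback f' p' p f) : WeakEquivalence f' := by
  -- Over the terminal object, `f` is a section `j` of a trivial fibration followed by a trivial
  -- fibration `q₂`; each factor is pulled back separately.
  obtain ⟨Z, j, q₁, q₂, hj₁, hj₂, -, _, _, _, _⟩ :=
    exists_brown_factorization_over (terminal.from B') (terminal.from B) f (by simp)
  have hZ := IsPullback.of_hasPullback p q₂
  have : WeakEquivalence (pullback.fst p q₂) := weakEquivalence_of_isPullback_of_fibration hZ.flip
  let k : E' ⟶ pullback p q₂ := pullback.lift f' (p' ≫ j) (by simp [h.w, hj₂])
  have hk : IsPullback k p' (pullback.snd p q₂) j := by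
    refine IsPullback.of_right (t := hZ) ?_ (pullback.lift_snd _ _ _)
    rw [pullback.lift_fst, hj₂]
    exact h
  have : WeakEquivalence k := weakEquivalence_baseChange_of_section hj₁ hk
  rw [show f' = k ≫ pullback.fst p q₂ from (pullback.lift_fst _ _ _).symm]
  infer_instance

/-- The homotopy invariance of pullbacks of fibrations between fibrant objects. -/
theorem weakEquivalence_map_of_isPullback {P B E D P' B' E' D' : C} {t : P ⟶ B} {l : P ⟶ E}
    {r : B ⟶ D} {b : E ⟶ D} {t' : P' ⟶ B'} {l' : P' ⟶ E'} {r' : B' ⟶ D'} {b' : E' ⟶ D'}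
    (h : IsPullback t l r b) (h' : IsPullback t' l' r' b') [IsFibrant D] [IsFibrant D']
    [Fibration r] [Fibration b] [Fibration r'] [Fibration b']
    {β : B ⟶ B'} {ε : E ⟶ E'} {δ : D ⟶ D'} [WeakEquivalence β] [WeakEquivalence ε]
    [WeakEquivalence δ] (hr : β ≫ r' = r ≫ δ) (hb : ε ≫ b' = b ≫ δ) (π : P ⟶ P')
    (ht : π ≫ t' = t ≫ β) (hl : π ≫ l' = l ≫ ε) : WeakEquivalence π := by
  have : IsFibrant B := isFibrant_of_fibration r
  have : IsFibrant E := isFibrant_of_fibration b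
  have : IsFibrant B' := isFibrant_of_fibration r'
  -- `π` is split in two: `k` replaces `E` by the base change of `E'` to `D`, and `m` then replaces
  -- `B` by `B'`. Each is a base change, along a fibration, of a weak equivalence between fibrant
  -- objects.
  have hQ := IsPullback.of_hasPullback b' δ
  have : IsFibrant (pullback b' δ) := isFibrant_of_fibration (pullback.snd b' δ)
  have : WeakEquivalence (pullback.fst b' δ) := weakEquivalence_baseChange_of_isFibrant hQ
  let e : E ⟶ pullback b' δ := pullback.lift ε b hb
  have : WeakEquivalence e :=
    weakEquivalence_of_postcomp_of_fac (g := pullback.fst b' δ) (pullback.lift_fst _ _ _)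
  have hR := IsPullback.of_hasPullback r (pullback.snd b' δ)
  have he : e ≫ pullback.fst b' δ = ε := pullback.lift_fst _ _ _
  have he' : e ≫ pullback.snd b' δ = b := pullback.lift_snd _ _ _
  let k : P ⟶ pullback r (pullback.snd b' δ) :=
    pullback.lift t (l ≫ e) (by rw [Category.assoc, he', h.w])
  have hk : IsPullback k l (pullback.snd r (pullback.snd b' δ)) e := by
    refine IsPullback.of_right (t := hR) ?_ (pullback.lift_snd _ _ _)
    rw [pullback.lift_fst, pullback.lift_snd]
    exact h
  have : WeakEquivalence k := weakEquivalence_baseChange_of_isFibrant hk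
  have hR' : IsPullback (pullback.snd r (pullback.snd b' δ) ≫ pullback.fst b' δ)
      (pullback.fst r (pullback.snd b' δ)) b' (β ≫ r') := by
    rw [hr]
    exact hR.flip.paste_horiz hQ
  let m : pullback r (pullback.snd b' δ) ⟶ P' :=
    h'.lift (pullback.fst _ _ ≫ β) (pullback.snd _ _ ≫ pullback.fst _ _)
      (by rw [hR'.w, Category.assoc])
  have hm : IsPullback m (pullback.fst r (pullback.snd b' δ)) t' β := by
    refine IsPullback.of_right (t := h'.flip) ?_ (h'.lift_fst _ _ _)
    rw [h'.lift_snd]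
    exact hR'
  have := fibration_of_isPullback h'.flip
  have : WeakEquivalence m := weakEquivalence_baseChange_of_isFibrant hm
  have hk₁ : k ≫ pullback.fst r (pullback.snd b' δ) = t := pullback.lift_fst _ _ _
  have hk₂ : k ≫ pullback.snd r (pullback.snd b' δ) = l ≫ e := pullback.lift_snd _ _ _
  have : k ≫ m = π := by
    apply h'.hom_ext
    · simp [m, reassoc_of% hk₁, ht]
    · simp [m, reassoc_of% hk₂, hl, he]
  rw [← this]
  infer_instance

end ModelCategory

/-! ### Homotopy cartesian squares and the pasting law -/

section HomotopyCartesian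

variable {C : Type u} [Category.{v} C] [ModelCategory C]

instance isFibrant_fibrantReplacement (D : C) : IsFibrant (fibrantReplacement D) := by
  rw [isFibrant_iff, Subsingleton.elim (terminal.from _) (fact (terminal.from D)).p]
  infer_instance

instance cofibration_toFibrantReplacement (D : C) : Cofibration (toFibrantReplacement D) :=
  inferInstanceAs (Cofibration (fact (terminal.from D)).i)

instance weakEquivalence_toFibrantReplacement (D : C) :
    WeakEquivalence (toFibrantReplacement D) :=
  inferInstanceAs (WeakEquivalence (fact (terminal.from D)).i)

theorem exists_lift_fact {B B' D' D'' : C} {f : B ⟶ D'} {β : B ⟶ B'} {r' : B' ⟶ D''}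
    {δ : D' ⟶ D''} [Fibration r'] [WeakEquivalence β] (w : β ≫ r' = f ≫ δ) :
    ∃ β' : (fact f).Z ⟶ B', (fact f).i ≫ β' = β ∧ β' ≫ r' = (fact f).p ≫ δ ∧
      WeakEquivalence β' := by
  have sq : CommSq β (fact f).i r' ((fact f).p ≫ δ) := ⟨by rw [w, ← Category.assoc, (fact f).fac]⟩
  exact ⟨sq.lift, sq.fac_left, sq.fac_right, weakEquivalence_of_precomp_of_fac sq.fac_left⟩

/-- Whether a square is homotopy cartesian can be tested on any replacement of its cospan by
fibrations between fibrant objects. -/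
theorem isHomotopyCartesian_iff {A B D E P B' D' E' : C} {t : A ⟶ B} {l : A ⟶ E} {r : B ⟶ D}
    {b : E ⟶ D} (sq : CommSq t l r b) {t' : P ⟶ B'} {l' : P ⟶ E'} {r' : B' ⟶ D'} {b' : E' ⟶ D'}
    (h : IsPullback t' l' r' b') [IsFibrant D'] [Fibration r'] [Fibration b'] (β : B ⟶ B')
    (ε : E ⟶ E') (δ : D ⟶ D') [WeakEquivalence β] [WeakEquivalence ε] [WeakEquivalence δ]
    (hr : β ≫ r' = r ≫ δ) (hb : ε ≫ b' = b ≫ δ) (α : A ⟶ P) (ht : α ≫ t' = t ≫ β)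
    (hl : α ≫ l' = l ≫ ε) : IsHomotopyCartesian sq ↔ WeakEquivalence α := by
  -- Lifting against trivial cofibrations maps the chosen replacement of the cospan to the given
  -- one, first on the base and then on the two legs.
  have sqD : CommSq δ (toFibrantReplacement D) (terminal.from D') (terminal.from _) := ⟨by simp⟩
  have : HasLiftingProperty (toFibrantReplacement D) (terminal.from D') := inferInstance
  have hδ : toFibrantReplacement D ≫ sqD.lift = δ := sqD.fac_left
  have : WeakEquivalence sqD.lift := weakEquivalence_of_precomp_of_fac hδ
  obtain ⟨β', hβ₁, hβ₂, _⟩ := exists_lift_fact (f := r ≫ toFibrantReplacement D) (β := β)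
    (r' := r') (δ := sqD.lift) (by rw [hr, Category.assoc, hδ])
  obtain ⟨ε', hε₁, hε₂, _⟩ := exists_lift_fact (f := b ≫ toFibrantReplacement D) (β := ε)
    (r' := b') (δ := sqD.lift) (by rw [hb, Category.assoc, hδ])
  have h₀ := IsPullback.of_hasPullback (fact (r ≫ toFibrantReplacement D)).p
    (fact (b ≫ toFibrantReplacement D)).p
  let π : homotopyPullback r b ⟶ P := h.lift (pullback.fst _ _ ≫ β') (pullback.snd _ _ ≫ ε')
    (by rw [Category.assoc, hβ₂, Category.assoc, hε₂, h₀.w_assoc])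
  have : WeakEquivalence π :=
    weakEquivalence_map_of_isPullback h₀ h hβ₂ hε₂ π (h.lift_fst _ _ _) (h.lift_snd _ _ _)
  have hα : toHomotopyPullback r b t l sq.w ≫ π = α := by
    apply h.hom_ext
    · rw [ht, Category.assoc, h.lift_fst, ← Category.assoc, toHomotopyPullback,
        pullback.lift_fst, Category.assoc, hβ₁]
    · rw [hl, Category.assoc, h.lift_snd, ← Category.assoc, toHomotopyPullback,
        pullback.lift_snd, Category.assoc, hε₁]
  rw [← hα, weakEquivalence_postcomp_iff]
  rfl

theorem IsHomotopyCartesian.flip {A B D E : C} {t : A ⟶ B} {l : A ⟶ E} {r : B ⟶ D}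
    {b : E ⟶ D} {sq : CommSq t l r b} (h : IsHomotopyCartesian sq) :
    IsHomotopyCartesian sq.flip := by
  refine (isHomotopyCartesian_iff sq.flip (IsPullback.of_hasPullback
    (fact (r ≫ toFibrantReplacement D)).p (fact (b ≫ toFibrantReplacement D)).p).flip
    (fact (b ≫ toFibrantReplacement D)).i (fact (r ≫ toFibrantReplacement D)).i
    (toFibrantReplacement D) (MorphismProperty.MapFactorizationData.fac _)
    (MorphismProperty.MapFactorizationData.fac _) (toHomotopyPullback r b t l sq.w)
    (pullback.lift_snd _ _ _) (pullback.lift_fst _ _ _)).2 h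

/-- The leg `b` may be replaced by the identity of the fibrant replacement of `D`, so the homotopy
pullback is just a replacement of `B`. -/
theorem isHomotopyCartesian_of_weakEquivalence {A B D E : C} {t : A ⟶ B} {l : A ⟶ E} {r : B ⟶ D}
    {b : E ⟶ D} (sq : CommSq t l r b) [WeakEquivalence t] [WeakEquivalence b] :
    IsHomotopyCartesian sq := by
  let f := fact (r ≫ toFibrantReplacement D)
  have h : IsPullback (𝟙 f.Z) f.p f.p (𝟙 _) := IsPullback.of_horiz_isIso ⟨by simp⟩
  have hf : f.i ≫ f.p = r ≫ toFibrantReplacement D := f.fac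
  exact (isHomotopyCartesian_iff sq h f.i (b ≫ toFibrantReplacement D) (toFibrantReplacement D)
    hf (Category.comp_id _) (t ≫ f.i) (Category.comp_id _)
    (by rw [Category.assoc, hf, sq.w_assoc])).2 inferInstance

/-- The pasting law for homotopy cartesian squares. -/
theorem isHomotopyCartesian_paste_horiz_iff {A₁ A₂ A₃ B₁ B₂ B₃ : C} {t : A₁ ⟶ A₂} {t' : A₂ ⟶ A₃}
    {l₁ : A₁ ⟶ B₁} {l₂ : A₂ ⟶ B₂} {l₃ : A₃ ⟶ B₃} {b : B₁ ⟶ B₂} {b' : B₂ ⟶ B₃}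
    (sq : CommSq t l₁ l₂ b) (sq' : CommSq t' l₂ l₃ b') (h : IsHomotopyCartesian sq') :
    IsHomotopyCartesian (sq.horiz_comp sq') ↔ IsHomotopyCartesian sq := by
  -- The right square is replaced by a strict pullback, which serves as replacement of `A₂` by
  -- hypothesis. A strict pullback of it over `f₂.Z` then computes both the left and the outer
  -- square, with the same comparison map `α`.
  let f₃ := fact (l₃ ≫ toFibrantReplacement B₃)
  let f₂ := fact (b' ≫ toFibrantReplacement B₃)
  let f₁ := fact (b ≫ f₂.i)
  have hf₃ : f₃.i ≫ f₃.p = l₃ ≫ toFibrantReplacement B₃ := f₃.fac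
  have hf₂ : f₂.i ≫ f₂.p = b' ≫ toFibrantReplacement B₃ := f₂.fac
  have hf₁ : f₁.i ≫ f₁.p = b ≫ f₂.i := f₁.fac
  have hP : IsPullback (pullback.fst f₃.p f₂.p) (pullback.snd f₃.p f₂.p) f₃.p f₂.p :=
    IsPullback.of_hasPullback _ _
  have hQ : IsPullback (pullback.fst (pullback.snd f₃.p f₂.p) f₁.p)
    (pullback.snd (pullback.snd f₃.p f₂.p) f₁.p) (pullback.snd f₃.p f₂.p) f₁.p :=
    IsPullback.of_hasPullback _ _
  let p : A₂ ⟶ pullback f₃.p f₂.p := toHomotopyPullback l₃ b' t' l₂ sq'.w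
  have : WeakEquivalence p := h
  have hp₁ : p ≫ pullback.fst f₃.p f₂.p = t' ≫ f₃.i := pullback.lift_fst _ _ _
  have hp₂ : p ≫ pullback.snd f₃.p f₂.p = l₂ ≫ f₂.i := pullback.lift_snd _ _ _
  let α : A₁ ⟶ pullback (pullback.snd f₃.p f₂.p) f₁.p := pullback.lift (t ≫ p) (l₁ ≫ f₁.i)
    (by rw [Category.assoc, hp₂, Category.assoc, hf₁, sq.w_assoc])
  have hα₁ : α ≫ pullback.fst (pullback.snd f₃.p f₂.p) f₁.p = t ≫ p := pullback.lift_fst _ _ _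
  have hα₂ : α ≫ pullback.snd (pullback.snd f₃.p f₂.p) f₁.p = l₁ ≫ f₁.i :=
    pullback.lift_snd _ _ _
  have : IsFibrant f₂.Z := isFibrant_of_fibration f₂.p
  rw [isHomotopyCartesian_iff sq hQ p f₁.i f₂.i hp₂ hf₁ α hα₁ hα₂]
  refine isHomotopyCartesian_iff _ (hQ.flip.paste_vert hP.flip).flip f₃.i f₁.i
    (toFibrantReplacement B₃) hf₃ ?_ α ?_ hα₂
  · rw [reassoc_of% hf₁, hf₂, Category.assoc]
  · rw [reassoc_of% hα₁, hp₁, Category.assoc]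

/-- The pasting law for homotopy cartesian squares, in the other direction. -/
theorem isHomotopyCartesian_paste_vert_iff {A₁ A₂ A₃ B₁ B₂ B₃ : C} {t : A₁ ⟶ A₂} {t' : A₂ ⟶ A₃}
    {l₁ : A₁ ⟶ B₁} {l₂ : A₂ ⟶ B₂} {l₃ : A₃ ⟶ B₃} {b : B₁ ⟶ B₂} {b' : B₂ ⟶ B₃}
    (sq : CommSq l₁ t b l₂) (sq' : CommSq l₂ t' b' l₃) (h : IsHomotopyCartesian sq') :
    IsHomotopyCartesian (sq.vert_comp sq') ↔ IsHomotopyCartesian sq :=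
  ⟨fun h' => ((isHomotopyCartesian_paste_horiz_iff sq.flip sq'.flip h.flip).1 h'.flip).flip,
    fun h' => ((isHomotopyCartesian_paste_horiz_iff sq.flip sq'.flip h.flip).2 h'.flip).flip⟩

end HomotopyCartesian

/-! ### Faces of simplices given by explicit formulas -/

section SimplexMaps

/-- The morphism `[p] ⟶ [n]` of the simplex category given by a monotone map of natural numbers. -/
def simplexMap {p n : ℕ} (f : ℕ → ℕ) (hf : Monotone f) (h : f p ≤ n) :
    SimplexCategory.mk p ⟶ SimplexCategory.mk n :=
  SimplexCategory.mkHom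
    ⟨fun x => ⟨f x, Nat.lt_succ_of_le ((hf (Nat.le_of_lt_succ x.2)).trans h)⟩,
      fun _ _ hxy => hf hxy⟩

theorem simplex_hom_ext {p n : ℕ} {f g : SimplexCategory.mk p ⟶ SimplexCategory.mk n}
    (h : ∀ x : Fin (p + 1), (f.toOrderHom x).val = (g.toOrderHom x).val) : f = g := by
  ext x : 3
  exact Fin.ext (h x)

theorem simplex_one_hom_ext {n : ℕ} {f g : SimplexCategory.mk 1 ⟶ SimplexCategory.mk n}
    (h₀ : (f.toOrderHom 0).val = (g.toOrderHom 0).val)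
    (h₁ : (f.toOrderHom 1).val = (g.toOrderHom 1).val) : f = g :=
  simplex_hom_ext (Fin.forall_fin_two.2 ⟨h₀, h₁⟩)

theorem val_succAbove_of_lt {n : ℕ} {i : Fin (n + 1)} {x : Fin n} (h : x.val < i.val) :
    (i.succAbove x).val = x := by
  rw [Fin.succAbove_of_castSucc_lt _ _ h, Fin.val_castSucc]

theorem val_succAbove_of_le {n : ℕ} {i : Fin (n + 1)} {x : Fin n} (h : i.val ≤ x.val) :
    (i.succAbove x).val = x + 1 := by
  rw [Fin.succAbove_of_le_castSucc _ _ h, Fin.val_succ]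

/-- The map `[j + 1] ⟶ [k + j]` with image `{0, 1, …, j, k + j}`. -/
def initialMap (j k : ℕ) : SimplexCategory.mk (j + 1) ⟶ SimplexCategory.mk (k + j) :=
  simplexMap (fun x => if x ≤ j then x else k + j)
    (fun x y h => by dsimp only; split_ifs <;> omega) (by simp)

/-- The map `[k] ⟶ [k + j]` with image `{j, j + 1, …, k + j}`. -/
def finalMap (j k : ℕ) : SimplexCategory.mk k ⟶ SimplexCategory.mk (k + j) :=
  simplexMap (fun x => x + j) (fun x y h => by dsimp only; omega) le_rfl

/-- The last edge `[1] ⟶ [j + 1]`. -/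
def lastEdge (j : ℕ) : SimplexCategory.mk 1 ⟶ SimplexCategory.mk (j + 1) :=
  simplexMap (fun x => x + j) (fun x y h => by dsimp only; omega) (by omega)

/-- The long edge `[1] ⟶ [k]` with image `{0, k}`. -/
def longEdge (k : ℕ) : SimplexCategory.mk 1 ⟶ SimplexCategory.mk k :=
  simplexMap (fun x => x * k) (fun _ _ h => Nat.mul_le_mul_right k h) (by simp)

theorem lastEdge_comp_initialMap (j k : ℕ) :
    lastEdge j ≫ initialMap j k = longEdge k ≫ finalMap j k := by
  apply simplex_one_hom_ext
  · change (if 0 + j ≤ j then 0 + j else k + j) = 0 * k + j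
    simp
  · change (if 1 + j ≤ j then 1 + j else k + j) = 1 * k + j
    simp

theorem finalMap_one (k : ℕ) : finalMap 1 k = SimplexCategory.δ 0 :=
  simplex_hom_ext fun _ => rfl

theorem finalMap_succ (j k : ℕ) :
    finalMap (j + 1) k = finalMap j k ≫ SimplexCategory.δ 0 :=
  simplex_hom_ext fun _ => rfl

theorem lastEdge_succ (j : ℕ) : lastEdge (j + 1) = lastEdge j ≫ SimplexCategory.δ 0 :=
  simplex_hom_ext fun _ => rfl

/-- The omitted vertex i + 1 lies strictly between 1 and k + 2, so the vertices 0, 1 and the last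
one survive. -/
theorem initialMap_comp_δ (k : ℕ) (i : Fin (k + 2)) (h0 : 0 < i) (h1 : i < Fin.last (k + 1)) :
    initialMap 1 k ≫ SimplexCategory.δ i.succ = initialMap 1 (k + 1) := by
  apply simplex_hom_ext
  intro x
  have hk : (if (x : ℕ) ≤ 1 then x.val else k + 1) < k + 2 := by split_ifs <;> omega
  change (Fin.succAbove i.succ ⟨if (x : ℕ) ≤ 1 then x else k + 1, hk⟩).val =
    if (x : ℕ) ≤ 1 then x.val else k + 1 + 1
  simp only [Fin.lt_def, Fin.val_zero, Fin.val_last] at h0 h1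
  obtain hx | hx := le_or_gt (x : ℕ) 1
  · simp only [if_pos hx]
    exact val_succAbove_of_lt (Nat.lt_succ_of_le (hx.trans h0))
  · simp only [if_neg hx.not_ge]
    exact val_succAbove_of_le h1

theorem longEdge_comp_δ (k : ℕ) (i : Fin (k + 2)) (h0 : 0 < i) (h1 : i < Fin.last (k + 1)) :
    longEdge k ≫ SimplexCategory.δ i = longEdge (k + 1) := by
  simp only [Fin.lt_def, Fin.val_zero, Fin.val_last] at h0 h1
  apply simplex_one_hom_ext
  · change (Fin.succAbove i ⟨0 * k, _⟩).val = 0 * (k + 1)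
    rw [val_succAbove_of_lt (by simpa using h0)]
    simp
  · change (Fin.succAbove i ⟨1 * k, _⟩).val = 1 * (k + 1)
    rw [val_succAbove_of_le (by simpa using Nat.le_of_lt_succ h1)]
    simp

theorem initialMap_comp_initialMap (j k : ℕ) :
    initialMap 1 (j + 1) ≫ initialMap (j + 1) k = initialMap 1 (k + j) := by
  apply simplex_hom_ext
  intro x
  change (if (if (x : ℕ) ≤ 1 then x.val else j + 1 + 1) ≤ j + 1 then
    (if (x : ℕ) ≤ 1 then x.val else j + 1 + 1) else k + (j + 1)) =
      if (x : ℕ) ≤ 1 then x.val else k + j + 1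
  split_ifs <;> omega

theorem longEdge_comp_initialMap (j k : ℕ) :
    longEdge (j + 1) ≫ initialMap j k = longEdge (k + j) := by
  apply simplex_one_hom_ext
  · change (if 0 * (j + 1) ≤ j then 0 * (j + 1) else k + j) = 0 * (k + j)
    simp
  · change (if 1 * (j + 1) ≤ j then 1 * (j + 1) else k + j) = 1 * (k + j)
    simp

/-- This is the auxiliary square of the induction on j. -/
theorem δ_comp_initialMap_succ (j k : ℕ) :
    SimplexCategory.δ 0 ≫ initialMap (j + 1) k = initialMap j k ≫ SimplexCategory.δ 0 := by
  apply simplex_hom_ext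
  intro x
  change (if (x : ℕ) + 1 ≤ j + 1 then (x : ℕ) + 1 else k + (j + 1)) =
    (if (x : ℕ) ≤ j then (x : ℕ) else k + j) + 1
  split_ifs <;> omega

/-- The shift to `k + 1` is needed: for k = 0 the last two vertices have the same image. -/
theorem strictMono_initialMap (j k : ℕ) : StrictMono (initialMap j (k + 1)).toOrderHom := by
  intro x y h
  have hy := y.2
  simp only [SimplexCategory.len_mk] at hy
  change (if (x : ℕ) ≤ j then (x : ℕ) else k + 1 + j) < if (y : ℕ) ≤ j then (y : ℕ) else k + 1 + j
  have h' : (x : ℕ) < y := h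
  split_ifs <;> omega

theorem strictMono_finalMap (j k : ℕ) : StrictMono (finalMap j k).toOrderHom :=
  fun x _ h => Nat.add_lt_add_right (n := (x : ℕ)) h j

theorem strictMono_longEdge (k : ℕ) : StrictMono (longEdge (k + 1)).toOrderHom :=
  fun x _ h => Nat.mul_lt_mul_of_pos_right (n := (x : ℕ)) h k.succ_pos

theorem isIso_initialMap_one (j : ℕ) : IsIso (initialMap j 1) := by
  refine SimplexCategory.isIso_of_bijective ((Fintype.bijective_iff_injective_and_card _).2
    ⟨(strictMono_initialMap j 0).injective, ?_⟩)
  simp [add_comm]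

theorem longEdge_one : longEdge 1 = 𝟙 _ := by
  apply simplex_hom_ext
  intro x
  exact Nat.mul_one _

theorem commSq_map_op {C : Type u} [Category.{v} C] (X : SimplicialObject C)
    {p q r n : SimplexCategory} {a : p ⟶ n} {b : q ⟶ n} {c : r ⟶ p} {d : r ⟶ q}
    (w : c ≫ a = d ≫ b) : CommSq (X.map a.op) (X.map b.op) (X.map c.op) (X.map d.op) :=
  ⟨by rw [← X.map_comp, ← X.map_comp, ← op_comp, ← op_comp, w]⟩

end SimplexMaps

/-! ### Pasting squares of faces: the upper condition -/

section SimplexSquares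

variable {C : Type u} [Category.{v} C] [ModelCategory C]

/-- Four maps form a commutative square which is homotopy cartesian. -/
def IsHoCartesian {A B D E : C} (t : A ⟶ B) (l : A ⟶ E) (r : B ⟶ D) (b : E ⟶ D) : Prop :=
  ∃ sq : CommSq t l r b, IsHomotopyCartesian sq

/-- With the commutativity proof under an existential, the four maps can be rewritten freely. -/
theorem isHomotopyCartesian_iff_isHoCartesian {A B D E : C} {t : A ⟶ B} {l : A ⟶ E} {r : B ⟶ D}
    {b : E ⟶ D} (sq : CommSq t l r b) : IsHomotopyCartesian sq ↔ IsHoCartesian t l r b :=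
  ⟨fun h => ⟨sq, h⟩, fun ⟨_, h⟩ => h⟩

theorem isHoCartesian_paste_horiz_iff {A₁ A₂ A₃ B₁ B₂ B₃ : C} {t : A₁ ⟶ A₂} {t' : A₂ ⟶ A₃}
    {l₁ : A₁ ⟶ B₁} {l₂ : A₂ ⟶ B₂} {l₃ : A₃ ⟶ B₃} {b : B₁ ⟶ B₂} {b' : B₂ ⟶ B₃}
    (w : CommSq t l₁ l₂ b) (h : IsHoCartesian t' l₂ l₃ b') :
    IsHoCartesian (t ≫ t') l₁ l₃ (b ≫ b') ↔ IsHoCartesian t l₁ l₂ b := by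
  obtain ⟨sq', h'⟩ := h
  rw [← isHomotopyCartesian_iff_isHoCartesian w,
    ← isHomotopyCartesian_iff_isHoCartesian (w.horiz_comp sq'),
    isHomotopyCartesian_paste_horiz_iff w sq' h']

theorem isHoCartesian_paste_vert_iff {A₁ A₂ A₃ B₁ B₂ B₃ : C} {t : A₁ ⟶ A₂} {t' : A₂ ⟶ A₃}
    {l₁ : A₁ ⟶ B₁} {l₂ : A₂ ⟶ B₂} {l₃ : A₃ ⟶ B₃} {b : B₁ ⟶ B₂} {b' : B₂ ⟶ B₃}
    (w : CommSq l₁ t b l₂) (h : IsHoCartesian l₂ t' b' l₃) :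
    IsHoCartesian l₁ (t ≫ t') (b ≫ b') l₃ ↔ IsHoCartesian l₁ t b l₂ := by
  obtain ⟨sq', h'⟩ := h
  rw [← isHomotopyCartesian_iff_isHoCartesian w,
    ← isHomotopyCartesian_iff_isHoCartesian (w.vert_comp sq'),
    isHomotopyCartesian_paste_vert_iff w sq' h']

theorem isHoCartesian_flip_iff {A B D E : C} {t : A ⟶ B} {l : A ⟶ E} {r : B ⟶ D}
    {b : E ⟶ D} : IsHoCartesian l t b r ↔ IsHoCartesian t l r b :=
  ⟨fun ⟨sq, h⟩ => ⟨sq.flip, h.flip⟩, fun ⟨sq, h⟩ => ⟨sq.flip, h.flip⟩⟩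

variable (X : SimplicialObject C)

/-- The square of `X_{k + j}`, `X_{0, …, j, k + j}`, `X_{j, …, k + j}` and `X_{j, k + j}` is
homotopy cartesian. -/
def IsCartesianAt (j k : ℕ) : Prop :=
  IsHoCartesian (X.map (initialMap j k).op) (X.map (finalMap j k).op) (X.map (lastEdge j).op)
    (X.map (longEdge k).op)

theorem isCartesianAt_one (j : ℕ) : IsCartesianAt X j 1 := by
  have := isIso_initialMap_one j
  have : IsIso (longEdge 1) := by rw [longEdge_one]; infer_instance
  exact ⟨commSq_map_op X (lastEdge_comp_initialMap j 1), isHomotopyCartesian_of_weakEquivalence _⟩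

/-- Pasting the upper square with the square (1, k) gives (1, k+1), whichever interior i is chosen.
-/
theorem isHomotopyCartesian_upperSquare_iff (k : ℕ) (i : Fin (k + 2)) (h0 : 0 < i)
    (h1 : i < Fin.last (k + 1)) (h : IsCartesianAt X 1 k) :
    IsHomotopyCartesian (upperSquare X k i) ↔ IsCartesianAt X 1 (k + 1) := by
  rw [IsCartesianAt, ← isHoCartesian_flip_iff, ← initialMap_comp_δ k i h0 h1,
    ← longEdge_comp_δ k i h0 h1, op_comp, op_comp, X.map_comp, X.map_comp, finalMap_one,
    isHomotopyCartesian_iff_isHoCartesian]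
  refine (isHoCartesian_paste_vert_iff (upperSquare X k i) ?_).symm
  rw [← isHoCartesian_flip_iff]
  rwa [IsCartesianAt, finalMap_one] at h

theorem isUpperTwoSegal_iff_isCartesianAt_one :
    IsUpperTwoSegal X ↔ ∀ k, IsCartesianAt X 1 (k + 1) := by
  constructor
  · intro h k
    induction k with
    | zero => exact isCartesianAt_one X 1
    | succ k ih =>
      have h0 : (0 : Fin (k + 1 + 2)) < 1 := by simp
      have h1 : (1 : Fin (k + 1 + 2)) < Fin.last (k + 1 + 1) := by simp [Fin.lt_def]
      exact (isHomotopyCartesian_upperSquare_iff X (k + 1) 1 h0 h1 ih).1 (h (k + 1) 1 h0 h1)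
  · intro h m i h0 h1
    cases m with
    -- Here n = 1, and no i satisfies 0 < i < 1.
    | zero => simp only [Fin.lt_def, Fin.val_zero, Fin.val_last] at h0 h1; omega
    | succ m => exact (isHomotopyCartesian_upperSquare_iff X (m + 1) i h0 h1 (h m)).2 (h _)

/-- The auxiliary square is homotopy cartesian because pasting it with (1, j+1) gives (1, k+j);
pasting it with (j, k) then gives (j+1, k). -/
theorem isCartesianAt_succ {j k : ℕ} (h : IsCartesianAt X 1 (k + j))
    (h₁ : IsCartesianAt X 1 (j + 1)) (h₂ : IsCartesianAt X j k) : IsCartesianAt X (j + 1) k := by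
  rw [IsCartesianAt, finalMap_succ, lastEdge_succ, op_comp, op_comp, X.map_comp, X.map_comp]
  have w := commSq_map_op X (δ_comp_initialMap_succ j k)
  refine (isHoCartesian_paste_vert_iff w h₂).2 ?_
  rw [IsCartesianAt, finalMap_one] at h₁
  refine (isHoCartesian_paste_horiz_iff w h₁).1 ?_
  rw [← X.map_comp, ← X.map_comp, ← op_comp, ← op_comp, longEdge_comp_initialMap,
    initialMap_comp_initialMap]
  rwa [IsCartesianAt, finalMap_one] at h

theorem isUpperTwoSegal_iff_isCartesianAt :
    IsUpperTwoSegal X ↔ ∀ j k, IsCartesianAt X (j + 1) (k + 1) := by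
  rw [isUpperTwoSegal_iff_isCartesianAt_one]
  refine ⟨fun h j k => ?_, fun h => h 0⟩
  induction j with
  | zero => exact h k
  | succ j ih =>
    refine isCartesianAt_succ X ?_ (h (j + 1)) ih
    rw [show k + 1 + (j + 1) = k + 1 + j + 1 from rfl]
    exact h _

end SimplexSquares

/-! ### Segal maps as squares of faces: the right condition -/

section SegalMaps

theorem mono_face {n : ℕ} (I : Finset (Fin (n + 1))) (hI : I.Nonempty) : Mono (face I hI) := by
  rw [SimplexCategory.mono_iff_injective]
  exact fun x y h => (vertexIso I hI).injective (Subtype.ext h)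

theorem isIso_face_of_eq_univ {n : ℕ} {I : Finset (Fin (n + 1))} (hI : I.Nonempty)
    (h : I = Finset.univ) : IsIso (face I hI) := by
  refine SimplexCategory.isIso_of_bijective
    ⟨fun x y h => (vertexIso I hI).injective (Subtype.ext h), fun y => ?_⟩
  refine ⟨(vertexIso I hI).symm ⟨y, h ▸ Finset.mem_univ y⟩, ?_⟩
  exact congrArg Subtype.val ((vertexIso I hI).apply_symm_apply _)

theorem isIso_faceIncl_of_eq {n : ℕ} {I J : Finset (Fin (n + 1))} (hI : I.Nonempty) (hIJ : I ⊆ J)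
    (h : I = J) : IsIso (faceIncl hI hIJ) := by
  subst h
  have : faceIncl hI hIJ = 𝟙 _ := by
    have := mono_face I hI
    rw [← cancel_mono (face I hI), Category.id_comp]
    exact faceIncl_comp_face hI hIJ
  rw [this]
  infer_instance

/-- A strictly monotone map `[p] ⟶ [n]` with image `I` is the face `I`. -/
theorem eq_face_of_strictMono {n : ℕ} {I : Finset (Fin (n + 1))} (hI : I.Nonempty)
    (a : SimplexCategory.mk (I.card - 1) ⟶ SimplexCategory.mk n) (ha : StrictMono a.toOrderHom)
    (h : ∀ y, y ∈ I ↔ ∃ x, a.toOrderHom x = y) : a = face I hI := by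
  ext x : 3
  exact congrFun (Finset.orderEmbOfFin_unique (card_eq hI) (f := a.toOrderHom)
    (fun x => (h _).2 ⟨x, rfl⟩) ha) x

theorem eq_card_sub_one_of_strictMono {n p : ℕ} {I : Finset (Fin (n + 1))}
    (a : SimplexCategory.mk p ⟶ SimplexCategory.mk n) (ha : StrictMono a.toOrderHom)
    (h : ∀ y, y ∈ I ↔ ∃ x, a.toOrderHom x = y) : p = I.card - 1 := by
  have : I = Finset.univ.image a.toOrderHom := by
    ext y
    rw [h]
    simp
  rw [this, Finset.card_image_of_injective _ ha.injective]
  simp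

variable {C : Type u} [Category.{v} C] [ModelCategory C] (X : SimplicialObject C)

/-- The Segal map of three faces is a weak equivalence if and only if the corresponding square is
homotopy cartesian, for any parametrization of the faces. -/
theorem weakEquivalence_segalMap_iff {n p q r : ℕ} {I J K : Finset (Fin (n + 1))}
    (hK : K.Nonempty) (hI : K ⊆ I) (hJ : K ⊆ J)
    {a : SimplexCategory.mk p ⟶ SimplexCategory.mk n}
    {b : SimplexCategory.mk q ⟶ SimplexCategory.mk n}
    {c : SimplexCategory.mk r ⟶ SimplexCategory.mk p}
    {d : SimplexCategory.mk r ⟶ SimplexCategory.mk q}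
    (ha : StrictMono a.toOrderHom) (hb : StrictMono b.toOrderHom)
    (hd : StrictMono d.toOrderHom) (w : c ≫ a = d ≫ b)
    (ha' : ∀ y, y ∈ I ↔ ∃ x, a.toOrderHom x = y)
    (hb' : ∀ y, y ∈ J ↔ ∃ x, b.toOrderHom x = y)
    (hd' : ∀ y, y ∈ K ↔ ∃ x, b.toOrderHom (d.toOrderHom x) = y) :
    WeakEquivalence (segalMap X hK hI hJ) ↔
      IsHoCartesian (X.map a.op) (X.map b.op) (X.map c.op) (X.map d.op) := by
  have hdb : StrictMono (d ≫ b).toOrderHom := hb.comp hd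
  have hdb' : ∀ y, y ∈ K ↔ ∃ x, (d ≫ b).toOrderHom x = y := hd'
  -- Strictly monotone maps are determined by their images, so all parameters can be replaced by the
  -- canonical ones; `c` and `d` are then forced because faces are monomorphisms.
  obtain rfl := eq_card_sub_one_of_strictMono a ha ha'
  obtain rfl := eq_card_sub_one_of_strictMono b hb hb'
  obtain rfl := eq_card_sub_one_of_strictMono (d ≫ b) hdb hdb'
  have hdK := eq_face_of_strictMono hK _ hdb hdb'
  have hcK := w.trans hdK
  obtain rfl := eq_face_of_strictMono (hK.mono hI) a ha ha'
  obtain rfl := eq_face_of_strictMono (hK.mono hJ) b hb hb'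
  have := mono_face I (hK.mono hI)
  have := mono_face J (hK.mono hJ)
  obtain rfl : c = faceIncl hK hI := by
    rw [← cancel_mono (face I (hK.mono hI)), hcK]
    exact (faceIncl_comp_face hK hI).symm
  obtain rfl : d = faceIncl hK hJ := by
    rw [← cancel_mono (face J (hK.mono hJ)), hdK]
    exact (faceIncl_comp_face hK hJ).symm
  exact isHomotopyCartesian_iff_isHoCartesian (commSq_map_op X w)

/-- Two opposite sides of the square are isomorphisms; this covers an extreme vertex. -/
theorem weakEquivalence_segalMap_of_left_eq_univ {n : ℕ} {I J K : Finset (Fin (n + 1))}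
    (hK : K.Nonempty) (hI : K ⊆ I) (hJ : K ⊆ J) (h : I = Finset.univ) (h' : K = J) :
    WeakEquivalence (segalMap X hK hI hJ) := by
  have := isIso_face_of_eq_univ (hK.mono hI) h
  have := isIso_faceIncl_of_eq hK hJ h'
  have : IsIso (toFace X I (hK.mono hI)) := inferInstanceAs (IsIso (X.map (face I _).op))
  have : IsIso (faceRestr X hK hJ) := inferInstanceAs (IsIso (X.map (faceIncl hK hJ).op))
  exact isHomotopyCartesian_of_weakEquivalence (t := toFace X I (hK.mono hI))
    (b := faceRestr X hK hJ) ⟨by rw [toFace_comp_faceRestr, toFace_comp_faceRestr]⟩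

theorem weakEquivalence_segalMap_of_right_eq_univ {n : ℕ} {I J K : Finset (Fin (n + 1))}
    (hK : K.Nonempty) (hI : K ⊆ I) (hJ : K ⊆ J) (h : J = Finset.univ) (h' : K = I) :
    WeakEquivalence (segalMap X hK hI hJ) := by
  have := isIso_face_of_eq_univ (hK.mono hJ) h
  have := isIso_faceIncl_of_eq hK hI h'
  have : IsIso (toFace X J (hK.mono hJ)) := inferInstanceAs (IsIso (X.map (face J _).op))
  have : IsIso (faceRestr X hK hI) := inferInstanceAs (IsIso (X.map (faceIncl hK hI).op))
  exact IsHomotopyCartesian.flip (isHomotopyCartesian_of_weakEquivalence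
    (t := toFace X J (hK.mono hJ)) (b := faceRestr X hK hI)
    ⟨by rw [toFace_comp_faceRestr, toFace_comp_faceRestr]⟩)

theorem exists_initialMap_eq_iff (j k : ℕ) (y : Fin (k + j + 1)) :
    (∃ x, (initialMap j k).toOrderHom x = y) ↔ (y : ℕ) ≤ j ∨ (y : ℕ) = k + j := by
  constructor
  · rintro ⟨x, rfl⟩
    change (if (x : ℕ) ≤ j then (x : ℕ) else k + j) ≤ j ∨
      (if (x : ℕ) ≤ j then (x : ℕ) else k + j) = k + j
    split_ifs <;> omega
  · rintro (h | h)
    · exact ⟨⟨y, by simp; omega⟩, Fin.ext (if_pos h)⟩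
    · refine ⟨Fin.last _, Fin.ext ((if_neg ?_).trans h.symm)⟩
      simp

theorem exists_finalMap_eq_iff (j k : ℕ) (y : Fin (k + j + 1)) :
    (∃ x, (finalMap j k).toOrderHom x = y) ↔ j ≤ (y : ℕ) := by
  constructor
  · rintro ⟨x, rfl⟩
    exact Nat.le_add_left _ _
  · intro h
    exact ⟨⟨y - j, by simp; omega⟩, Fin.ext (Nat.sub_add_cancel h)⟩

theorem exists_finalMap_longEdge_eq_iff (j k : ℕ) (y : Fin (k + j + 1)) :
    (∃ x, (finalMap j k).toOrderHom ((longEdge k).toOrderHom x) = y) ↔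
      (y : ℕ) = j ∨ (y : ℕ) = k + j := by
  constructor
  · rintro ⟨x, rfl⟩
    have hx : x = 0 ∨ x = 1 := by
      revert x
      exact Fin.forall_fin_two.2 ⟨Or.inl rfl, Or.inr rfl⟩
    obtain rfl | rfl := hx
    · exact Or.inl (show 0 * k + j = j by simp)
    · exact Or.inr (show 1 * k + j = k + j by simp)
  · rintro (h | h)
    · exact ⟨0, Fin.ext (show 0 * k + j = y by simp [h])⟩
    · exact ⟨1, Fin.ext (show 1 * k + j = y by simp [h])⟩

theorem weakEquivalence_rightSegalMap_iff (j k : ℕ) (i : Fin (k + 1 + (j + 1) + 1))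
    (hi : (i : ℕ) = j + 1) :
    WeakEquivalence (segalMap X (Finset.insert_nonempty i {Fin.last _})
      (pair_subset_upToAndLast i) (pair_subset_fromOn i)) ↔ IsCartesianAt X (j + 1) (k + 1) := by
  refine weakEquivalence_segalMap_iff X _ _ _ (strictMono_initialMap _ _)
    (strictMono_finalMap _ _) (strictMono_longEdge _) (lastEdge_comp_initialMap _ _) ?_ ?_ ?_
  · intro y
    rw [exists_initialMap_eq_iff, upToAndLast, Finset.mem_insert, Finset.mem_Iic, Fin.ext_iff,
      Fin.le_def, hi, Fin.val_last, or_comm]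
  · intro y
    rw [exists_finalMap_eq_iff, fromOn, Finset.mem_Ici, Fin.le_def, hi]
  · intro y
    rw [exists_finalMap_longEdge_eq_iff, Finset.mem_insert, Finset.mem_singleton, Fin.ext_iff,
      Fin.ext_iff, hi, Fin.val_last]

theorem isRightTwoSegal_iff_isCartesianAt :
    IsRightTwoSegal X ↔ ∀ j k, IsCartesianAt X (j + 1) (k + 1) := by
  constructor
  · intro h j k
    cases k with
    -- The case k = 1 includes n = 2, about which the Segal condition says nothing; in the remaining
    -- cases n ≥ 3.
    | zero => exact isCartesianAt_one X (j + 1)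
    | succ k =>
      exact (weakEquivalence_rightSegalMap_iff X j (k + 1)
        ⟨j + 1, by omega⟩ rfl).1 (h _ (by omega) _)
  · rintro h n - i
    rcases hj : (i : ℕ) with _ | j
    · obtain rfl : i = 0 := Fin.ext hj
      refine weakEquivalence_segalMap_of_right_eq_univ X _ _ _ ?_ ?_
      · ext y; simp [fromOn]
      · ext y; simp [upToAndLast, or_comm]
    · rcases hk : (n - i : ℕ) with _ | k
      · obtain rfl : i = Fin.last n := Fin.ext (by simp; omega)
        refine weakEquivalence_segalMap_of_left_eq_univ X _ _ _ ?_ ?_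
        · ext y; simp [upToAndLast, Fin.le_last]
        · ext y; simp [fromOn, Fin.last_le_iff]
      · obtain rfl : n = k + 1 + (j + 1) := by omega
        exact (weakEquivalence_rightSegalMap_iff X j k i hj).2 (h j k)

theorem isUpperTwoSegal_iff_isRightTwoSegal : IsUpperTwoSegal X ↔ IsRightTwoSegal X :=
  (isUpperTwoSegal_iff_isCartesianAt X).trans (isRightTwoSegal_iff_isCartesianAt X).symm

end SegalMaps

/-! ### Reversal of vertices: the lower and left conditions -/

section Reversal

variable {C : Type u} [Category.{v} C] [ModelCategory C] (X : SimplicialObject C)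

/-- The simplicial object `X` with the order of all vertices reversed. -/
def reversal {C : Type u} [Category.{v} C] (X : SimplicialObject C) : SimplicialObject C :=
  SimplexCategory.rev.op ⋙ X

theorem strictMono_rev_map {p n : ℕ} {a : SimplexCategory.mk p ⟶ SimplexCategory.mk n}
    (ha : StrictMono a.toOrderHom) : StrictMono (SimplexCategory.rev.map a).toOrderHom :=
  fun _ _ h => Fin.rev_lt_rev.2 (ha (Fin.rev_lt_rev.2 h))

theorem exists_rev_map_eq_iff {p n : ℕ} (a : SimplexCategory.mk p ⟶ SimplexCategory.mk n)
    (y : Fin (n + 1)) :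
    (∃ x, (SimplexCategory.rev.map a).toOrderHom x = y) ↔ ∃ x, a.toOrderHom x = y.rev :=
  ⟨fun ⟨x, h⟩ => ⟨Fin.rev x, Fin.rev_eq_iff.1 h⟩,
    fun ⟨x, h⟩ => ⟨Fin.rev x, Fin.rev_eq_iff.2 ((congrArg a.toOrderHom (Fin.rev_rev x)).trans h)⟩⟩

theorem isHomotopyCartesian_upperSquare_reversal_iff (m : ℕ) (i : Fin (m + 2)) :
    IsHomotopyCartesian (upperSquare (reversal X) m i) ↔
      IsHomotopyCartesian (lowerSquare X m i.rev) := by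
  have h (n : ℕ) (j : Fin (n + 2)) : (reversal X).δ j = X.δ j.rev :=
    congrArg (fun f : SimplexCategory.mk n ⟶ SimplexCategory.mk (n + 1) => X.map f.op)
      (SimplexCategory.rev_map_δ j)
  rw [isHomotopyCartesian_iff_isHoCartesian, isHomotopyCartesian_iff_isHoCartesian, h, h, h, h,
    Fin.rev_zero, Fin.rev_zero, Fin.rev_succ]
  rfl

theorem isUpperTwoSegal_reversal_iff : IsUpperTwoSegal (reversal X) ↔ IsLowerTwoSegal X := by
  constructor
  · intro h m i h0 h1
    have := h m i.rev (by rwa [← Fin.rev_last, Fin.rev_lt_rev])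
      (by rwa [← Fin.rev_zero, Fin.rev_lt_rev])
    rwa [isHomotopyCartesian_upperSquare_reversal_iff, Fin.rev_rev] at this
  · intro h m i h0 h1
    rw [isHomotopyCartesian_upperSquare_reversal_iff]
    exact h m i.rev (by rwa [← Fin.rev_last, Fin.rev_lt_rev])
      (by rwa [← Fin.rev_zero, Fin.rev_lt_rev])

/-- With n = k + j + 2, reversal takes the vertex k + 1 to j + 1, hence {0, i, …, n} to {0, …, j+1,
n} and {0, …, i} to {j+1, …, n}. -/
theorem weakEquivalence_leftSegalMap_iff (j k : ℕ) (i : Fin (k + 1 + (j + 1) + 1))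
    (hi : (i : ℕ) = k + 1) :
    WeakEquivalence (segalMap X (Finset.insert_nonempty 0 {i})
      (pair_subset_zeroAndFrom i) (pair_subset_upTo i)) ↔
        IsCartesianAt (reversal X) (j + 1) (k + 1) := by
  refine weakEquivalence_segalMap_iff X _ _ _
    (a := SimplexCategory.rev.map (initialMap (j + 1) (k + 1)))
    (b := SimplexCategory.rev.map (finalMap (j + 1) (k + 1)))
    (c := SimplexCategory.rev.map (lastEdge (j + 1)))
    (d := SimplexCategory.rev.map (longEdge (k + 1)))
    (strictMono_rev_map (strictMono_initialMap _ _))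
    (strictMono_rev_map (strictMono_finalMap _ _)) (strictMono_rev_map (strictMono_longEdge _))
    ?_ ?_ ?_ ?_
  · rw [← Functor.map_comp, ← Functor.map_comp, lastEdge_comp_initialMap]
  · intro y
    refine Iff.trans ?_ ((exists_rev_map_eq_iff (initialMap (j + 1) (k + 1)) y).trans
      (exists_initialMap_eq_iff _ _ _)).symm
    rw [zeroAndFrom, Finset.mem_insert, Finset.mem_Ici, Fin.ext_iff, Fin.le_def, hi, Fin.val_rev, Fin.val_zero]
    omega
  · intro y
    refine Iff.trans ?_ ((exists_rev_map_eq_iff (finalMap (j + 1) (k + 1)) y).trans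
      (exists_finalMap_eq_iff _ _ _)).symm
    rw [upTo, Finset.mem_Iic, Fin.le_def, hi, Fin.val_rev]
    omega
  · intro y
    have := (exists_rev_map_eq_iff (longEdge (k + 1) ≫ finalMap (j + 1) (k + 1)) y).trans
      (exists_finalMap_longEdge_eq_iff _ _ _)
    rw [Functor.map_comp] at this
    refine Iff.trans ?_ this.symm
    rw [Finset.mem_insert, Finset.mem_singleton, Fin.ext_iff, Fin.ext_iff, hi, Fin.val_rev,
      Fin.val_zero]
    omega

theorem isLeftTwoSegal_iff_isCartesianAt :
    IsLeftTwoSegal X ↔ ∀ j k, IsCartesianAt (reversal X) (j + 1) (k + 1) := by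
  constructor
  · intro h j k
    cases k with
    | zero => exact isCartesianAt_one (reversal X) (j + 1)
    | succ k =>
      exact (weakEquivalence_leftSegalMap_iff X j (k + 1)
        ⟨k + 1 + 1, by omega⟩ rfl).1 (h _ (by omega) _)
  · rintro h n - i
    rcases hk : (i : ℕ) with _ | k
    · obtain rfl : i = 0 := Fin.ext hk
      refine weakEquivalence_segalMap_of_left_eq_univ X _ _ _ ?_ ?_
      · ext y; simp [zeroAndFrom]
      · ext y; simp [upTo]
    · rcases hj : (n - i : ℕ) with _ | j
      · obtain rfl : i = Fin.last n := Fin.ext (by simp; omega)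
        refine weakEquivalence_segalMap_of_right_eq_univ X _ _ _ ?_ ?_
        · ext y; simp [upTo, Fin.le_last]
        · ext y; simp [zeroAndFrom, Fin.last_le_iff]
      · obtain rfl : n = k + 1 + (j + 1) := by omega
        exact (weakEquivalence_leftSegalMap_iff X j k i hk).2 (h j k)

theorem isLowerTwoSegal_iff_isLeftTwoSegal : IsLowerTwoSegal X ↔ IsLeftTwoSegal X := by
  rw [← isUpperTwoSegal_reversal_iff, isUpperTwoSegal_iff_isCartesianAt,
    isLeftTwoSegal_iff_isCartesianAt]

end Reversal

end TwoSegal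

theorem propositionA2 {C : Type u} [Category.{v} C] [ModelCategory C] (X : SimplicialObject C) :
    (TwoSegal.IsUpperTwoSegal X ↔ TwoSegal.IsRightTwoSegal X) ∧
      (TwoSegal.IsLowerTwoSegal X ↔ TwoSegal.IsLeftTwoSegal X) :=
  ⟨TwoSegal.isUpperTwoSegal_iff_isRightTwoSegal X, TwoSegal.isLowerTwoSegal_iff_isLeftTwoSegal X⟩
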